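/- For a set $A$ of positive integers and a positive integer $N$, let $S_N^{(A)}$ be the set of all permutations of $\{1,\dots,N\}$ all of whose cycles (fixed points being cycles of length $1$) have length in $A$. For $k\in A$, $i\in\{1,\dots,N\}$ and $N$ with $S_N^{(A)}\neq\emptyset$, let $$p_N^{(A)}(k)=\frac{\operatorname{card}\{\sigma\in S_N^{(A)} : i\text{ belongs to a cycle of }\sigma\text{ of length }k\}}{\operatorname{card}S_N^{(A)}},$$ the probability that $i$ lies in a $k$-cycle of a uniformly random permutation in $S_N^{(A)}$; by symmetry it does not depend on $i$. **Proposition.** Let $A$ be a non-empty set of positive integers such that either $A$ is finite, or $\sum_{j\in\{1,2,3,\dots\}\setminus A}\frac1j<\infty$. Let $k\in A$ and $d=\sup A\in\{1,2,\dots\}\cup\{\infty\}$. Then $$p_N^{(A)}(k)\sim N^{(k/d)-1}\qquad\text{as }N\to\infty\text{ with }S_N^{(A)}\neq\emptyset,$$ with the convention $k/\infty:=0$; that is, for every choice of the points $i=i_N\in\{1,\dots,N\}$, the quotient of the two sides tends to $1$ as $N\to\infty$ through the integers $N$ with $S_N^{(A)}\neq\emptyset$. -/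

import Mathlib

open Filter Asymptotics

noncomputable section

/-- The length of the cycle of the permutation `σ` that contains the point `i`: the least `n ≥ 1`
with `σ ^ n` fixing `i`. A fixed point lies in a cycle of length `1`. -/
def cycleLength {N : ℕ} (σ : Equiv.Perm (Fin N)) (i : Fin N) : ℕ :=
  Function.minimalPeriod σ i

/-- The set `S_N^(A)` of the permutations of `N` points all of whose cycles (fixed points
included) have length in `A`. -/
def restrictedPerms (A : Set ℕ) (N : ℕ) : Set (Equiv.Perm (Fin N)) :=
  {σ | ∀ i : Fin N, cycleLength σ i ∈ A}

/-- The probability `p_N^(A)(k)` that the point `i` lies in a cycle of length `k` of a uniformly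
random element of `S_N^(A)`, as a quotient of cardinalities. -/
def cycleProb (A : Set ℕ) (k N : ℕ) (i : Fin N) : ℝ :=
  ({σ | σ ∈ restrictedPerms A N ∧ cycleLength σ i = k} : Set (Equiv.Perm (Fin N))).ncard /
    (restrictedPerms A N).ncard

/-- The supremum `d` of a set of natural numbers, equal to `∞` if the set is unbounded. -/
def supLength (A : Set ℕ) : ENNReal :=
  ⨆ a ∈ A, (a : ENNReal)

/-- The number `k / d`, where `k / ∞ = 0`. -/
def lengthRatio (A : Set ℕ) (k : ℕ) : ℝ :=
  ((k : ENNReal) / supLength A).toReal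

end

/-!
Write `a n = |S_n^(A)| / n!` (`restrictedDensity`). Deleting a point from its cycle shows that the
permutations of `N` points having a given point in a `k`-cycle, and all other cycle lengths in `A`,
number `(N - 1) ⋯ (N - k + 1) |S_{N-k}^(A)|`. Hence the probability in question is
`a (N - k) / (N a N)` (`cycleProb_eq`), and summing over `k` gives the recurrence
`N a N = ∑_{j ∈ A} a (N - j)` (`restrictedDensity_succ`), which says that the generating function of
`a` is `exp (∑_{j ∈ A} z ^ j / j)`. It remains to see that `a (N - k) / a N ~ N ^ (k / d)`.

If the complement `B` of `A` has a convergent sum of reciprocals, let `b` be the densities of `B`.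
The product of the two generating functions is `1 / (1 - X)`, and the coefficients of
`(1 - X) ∑ a n X ^ n` are bounded in absolute value by the `b n`, which are summable. So `a` tends
to a limit `L` with `L * ∑ b n = 1`; thus `L ≠ 0` and `a (N - k) / a N → 1`
(`exists_tendsto_restrictedDensity`).

If `A` is finite with maximum `d` and greatest common divisor `g`, the generating function is entire
and the saddle point method applies. Take `r` with `∑_{j ∈ A} r ^ j = N`, so that `r ^ d ~ N`.
For `l = 0` and for `l = k`, the coefficient `a (N - l) r ^ (N - l)`, with the same normalizing
factor, is a Fourier integral over `[-π / g, π / g]`; after the scaling `θ = t / √(d r ^ d)` it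
converges to the Gaussian integral by dominated convergence
(`tendsto_integral_exp_saddleExponent`). As the limit does not depend on `l`, the quotient
`a (N - k) / a N` is asymptotic to `r ^ k`, hence to `N ^ (k / d)`.
-/

/-! ### Deleting a point from its cycle -/

section Combinatorics

open Function

/-- `f` has `i` in a cycle of length `k`, and every cycle of `f` not passing through `i` has length
in `A`. Leaving the cycle through `i` unrestricted makes the notion stable under deletion of a point
of that cycle. -/
def IsRootedRestricted {α : Type*} (A : Set ℕ) (f : α → α) (k : ℕ) (i : α) : Prop :=
  minimalPeriod f i = k ∧ ∀ j, (∀ n : ℕ, f^[n] i ≠ j) → minimalPeriod f j ∈ A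

lemma minimalPeriod_eq_of_iterate_injective {α β : Type*} {f : α → α} {g : β → β} {φ : α → β}
    (hφ : Injective φ) {a : α} (h : ∀ n, g^[n] (φ a) = φ (f^[n] a)) :
    minimalPeriod g (φ a) = minimalPeriod f a := by
  rw [minimalPeriod_eq_minimalPeriod_iff]
  intro n
  rw [IsPeriodicPt, IsPeriodicPt, IsFixedPt, IsFixedPt, h, hφ.eq_iff]

lemma isRootedRestricted_permCongr {α β : Type*} (e : α ≃ β) (A : Set ℕ) (σ : Equiv.Perm α)
    (k : ℕ) (i : α) :
    IsRootedRestricted A (e.permCongr σ) k (e i) ↔ IsRootedRestricted A σ k i := by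
  have h : ∀ (j : α) (n : ℕ), (e.permCongr σ)^[n] (e j) = e (σ^[n] j) := by
    intro j n
    have : Semiconj e σ (e.permCongr σ) := fun x => by simp [Equiv.permCongr_apply]
    exact ((this.iterate_right n) j).symm
  have hp : ∀ j, minimalPeriod (e.permCongr σ) (e j) = minimalPeriod σ j := fun j =>
    minimalPeriod_eq_of_iterate_injective e.injective (h j)
  simp only [IsRootedRestricted, hp, h, e.surjective.forall, e.injective.ne_iff]

section Insert

variable {α : Type*} [DecidableEq α] (τ : Equiv.Perm α)

lemma decomposeOption_symm_none_apply_some (a : α) :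
    Equiv.Perm.decomposeOption.symm (none, τ) (some a) = some (τ a) := by
  simp [Equiv.Perm.decomposeOption_symm_apply]

lemma decomposeOption_symm_apply_none (x : Option α) :
    Equiv.Perm.decomposeOption.symm (x, τ) none = x := by
  simp [Equiv.Perm.decomposeOption_symm_apply]

lemma decomposeOption_symm_some_apply_of_eq {y a : α} (h : τ a = y) :
    Equiv.Perm.decomposeOption.symm (some y, τ) (some a) = none := by
  simp [Equiv.Perm.decomposeOption_symm_apply, h]

lemma decomposeOption_symm_some_apply_of_ne {y a : α} (h : τ a ≠ y) :
    Equiv.Perm.decomposeOption.symm (some y, τ) (some a) = some (τ a) := by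
  simp only [Equiv.Perm.decomposeOption_symm_apply, Equiv.Perm.coe_mul, comp_apply,
    Equiv.optionCongr_apply, Option.map_some]
  exact Equiv.swap_apply_of_ne_of_ne (by simp) (by simpa using h)

lemma isRootedRestricted_decomposeOption_symm_none (A : Set ℕ) (k : ℕ) :
    IsRootedRestricted A (Equiv.Perm.decomposeOption.symm (none, τ)) k none ↔
      k = 1 ∧ ∀ j, minimalPeriod τ j ∈ A := by
  set σ := Equiv.Perm.decomposeOption.symm (none, τ) with hσ
  have h0 : σ none = none := decomposeOption_symm_apply_none τ none
  have hit : ∀ n : ℕ, σ^[n] none = none := fun n => iterate_fixed h0 n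
  have hs : ∀ (n : ℕ) (a : α), σ^[n] (some a) = some (τ^[n] a) := by
    intro n
    induction n with
    | zero => simp
    | succ n ih =>
      intro a
      rw [iterate_succ_apply, iterate_succ_apply, hσ, decomposeOption_symm_none_apply_some, ← hσ,
        ih]
  have hp : ∀ a, minimalPeriod σ (some a) = minimalPeriod τ a := fun a =>
    minimalPeriod_eq_of_iterate_injective (Option.some_injective α) (fun n => hs n a)
  simp [IsRootedRestricted, minimalPeriod_eq_one_iff_isFixedPt.2 h0, hit, Option.forall, hp,
    eq_comm]

/-- Inserting a new point `none` before `y` lengthens the cycle of `y` by one and changes no other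
cycle. -/
lemma isRootedRestricted_decomposeOption_symm_some [Finite α] (A : Set ℕ) (y : α) (k : ℕ) :
    IsRootedRestricted A (Equiv.Perm.decomposeOption.symm (some y, τ)) (k + 1) none ↔
      IsRootedRestricted A τ k y := by
  set σ := Equiv.Perm.decomposeOption.symm (some y, τ) with hσ
  have h0 : σ none = some y := decomposeOption_symm_apply_none τ (some y)
  have hτ : ∀ a, a ∈ periodicPts τ := fun a => τ.injective.mem_periodicPts a
  set m := minimalPeriod τ y with hm
  have hm0 : 0 < m := minimalPeriod_pos_of_mem_periodicPts (hτ y)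
  have hit : ∀ j : ℕ, j < m → σ^[j + 1] none = some (τ^[j] y) := by
    intro j
    induction j with
    | zero => simp [h0]
    | succ j ih =>
      intro hj
      rw [iterate_succ_apply', ih (by omega), iterate_succ_apply']
      refine decomposeOption_symm_some_apply_of_ne τ fun h => ?_
      rw [← iterate_succ_apply' τ] at h
      exact not_isPeriodicPt_of_pos_of_lt_minimalPeriod (Nat.succ_ne_zero j) hj h
  have hret : σ^[m + 1] none = none := by
    obtain ⟨m', hm'⟩ : ∃ m', m = m' + 1 := ⟨m - 1, by omega⟩
    rw [iterate_succ_apply', hm', hit m' (by omega)]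
    refine decomposeOption_symm_some_apply_of_eq τ ?_
    rw [← iterate_succ_apply' τ, Nat.succ_eq_add_one, ← hm']
    exact iterate_minimalPeriod
  have hper : minimalPeriod σ none = m + 1 := by
    refine le_antisymm (IsPeriodicPt.minimalPeriod_le (Nat.succ_pos m) hret) ?_
    by_contra! hlt
    have hpos : 0 < minimalPeriod σ none :=
      minimalPeriod_pos_of_mem_periodicPts (mk_mem_periodicPts (Nat.succ_pos m) hret)
    obtain ⟨p, hp⟩ : ∃ p, minimalPeriod σ none = p + 1 := ⟨_, (Nat.sub_add_cancel hpos).symm⟩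
    have h1 : σ^[p + 1] none = none := hp ▸ iterate_minimalPeriod
    rw [hit p (by omega)] at h1
    exact Option.some_ne_none _ h1
  have horb : ∀ j, (∀ n : ℕ, σ^[n] none ≠ some j) ↔ ∀ n : ℕ, τ^[n] y ≠ j := by
    intro j
    constructor
    · rintro h n rfl
      refine h (n % m + 1) ?_
      rw [hit _ (Nat.mod_lt _ hm0), iterate_mod_minimalPeriod_eq]
    · intro h n hn
      -- The orbit of `none` under `σ` stays in the orbit of `y` under `τ`, together with `none`.
      have key : ∀ n : ℕ, σ^[n] none = none ∨ ∃ l : ℕ, σ^[n] none = some (τ^[l] y) := by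
        intro n
        induction n with
        | zero => simp
        | succ n ih =>
          rw [iterate_succ_apply']
          rcases ih with ih | ⟨l, ih⟩
          · right; exact ⟨0, by rw [ih, h0]; rfl⟩
          · rw [ih]
            by_cases hy : τ (τ^[l] y) = y
            · left; exact decomposeOption_symm_some_apply_of_eq τ hy
            · right
              exact ⟨l + 1, by
                rw [iterate_succ_apply', hσ, decomposeOption_symm_some_apply_of_ne τ hy]⟩
      rcases key n with h1 | ⟨l, h1⟩
      · rw [h1] at hn; exact absurd hn (by simp)
      · rw [h1] at hn; exact h l (Option.some_injective _ hn)
  have hoff : ∀ j, (∀ n : ℕ, τ^[n] y ≠ j) → minimalPeriod σ (some j) = minimalPeriod τ j := by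
    intro j hj
    have hne : ∀ n : ℕ, τ^[n] j ≠ y := by
      intro n hn
      set p := minimalPeriod τ j with hp
      have hp0 : 0 < p := minimalPeriod_pos_of_mem_periodicPts (hτ j)
      refine hj (p * n - n) ?_
      rw [← hn, ← iterate_add_apply, Nat.sub_add_cancel (Nat.le_mul_of_pos_left n hp0)]
      exact (isPeriodicPt_minimalPeriod τ j).mul_const n
    refine minimalPeriod_eq_of_iterate_injective (Option.some_injective α) (fun n => ?_)
    induction n with
    | zero => rfl
    | succ n ih =>
      rw [iterate_succ_apply', ih, iterate_succ_apply']
      refine decomposeOption_symm_some_apply_of_ne τ ?_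
      rw [← iterate_succ_apply' τ]
      exact hne _
  constructor
  · rintro ⟨h1, h2⟩
    refine ⟨by omega, fun j hj => ?_⟩
    rw [← hoff j hj]
    exact h2 _ ((horb j).2 hj)
  · rintro ⟨h1, h2⟩
    refine ⟨by omega, ?_⟩
    rintro (_ | j) hj
    · exact absurd rfl (hj 0)
    · have := (horb j).1 hj
      rw [hoff j this]
      exact h2 j this

end Insert

/-- The number of permutations of `n` points with all cycle lengths in `A`. -/
noncomputable def restrictedCount (A : Set ℕ) (n : ℕ) : ℕ := (restrictedPerms A n).ncard

lemma ncard_setOf_eq_sum {β : Type*} [Fintype β] (p : β → Prop) [DecidablePred p] :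
    {x | p x}.ncard = ∑ x, if p x then 1 else 0 := by
  rw [← Finset.card_filter, ← Set.ncard_coe_finset]
  simp

lemma ncard_isRootedRestricted_congr {α β : Type*} (e : α ≃ β) (A : Set ℕ)
    (k : ℕ) (i : α) :
    {σ : Equiv.Perm β | IsRootedRestricted A σ k (e i)}.ncard =
      {σ : Equiv.Perm α | IsRootedRestricted A σ k i}.ncard := by
  rw [← Set.ncard_image_of_injective _ e.permCongr.injective]
  congr 1
  ext σ
  obtain ⟨σ, rfl⟩ := e.permCongr.surjective σ
  rw [e.permCongr.injective.mem_set_image]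
  exact isRootedRestricted_permCongr e A σ k i

lemma ncard_isRootedRestricted_option {n : ℕ} (A : Set ℕ) (k : ℕ) :
    {σ : Equiv.Perm (Option (Fin n)) | IsRootedRestricted A σ (k + 1) none}.ncard =
      (if k = 0 then restrictedCount A n else 0) +
        ∑ y, {σ : Equiv.Perm (Fin n) | IsRootedRestricted A σ k y}.ncard := by
  classical
  simp only [ncard_setOf_eq_sum, restrictedCount, restrictedPerms, cycleLength]
  rw [← Equiv.sum_comp Equiv.Perm.decomposeOption.symm, Fintype.sum_prod_type, Fintype.sum_option]
  simp only [isRootedRestricted_decomposeOption_symm_none,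
    isRootedRestricted_decomposeOption_symm_some]
  by_cases hk : k = 0 <;> simp [hk, -Finset.sum_boole]

lemma not_isRootedRestricted_zero {α : Type*} [Finite α] (A : Set ℕ) (σ : Equiv.Perm α) (i : α) :
    ¬ IsRootedRestricted A σ 0 i := fun h =>
  (minimalPeriod_pos_of_mem_periodicPts (σ.injective.mem_periodicPts i)).ne' h.1

/-- The cycle of `i` is shortened `k` times by deleting a point and moving on to its successor.
The choices of the successors contribute the factor `n.descFactorial k`; the point left at the end
is a fixed point, and the remaining `n - k` points are permuted with all cycle lengths in `A`. -/
lemma ncard_isRootedRestricted (A : Set ℕ) (k : ℕ) : ∀ (n : ℕ) (i : Fin (n + 1)),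
    {σ : Equiv.Perm (Fin (n + 1)) | IsRootedRestricted A σ (k + 1) i}.ncard =
      n.descFactorial k * restrictedCount A (n - k) := by
  induction k with
  | zero =>
    intro n i
    have h := ncard_isRootedRestricted_congr (finSuccEquiv' i).symm A (0 + 1) none
    rw [finSuccEquiv'_symm_none] at h
    rw [h, ncard_isRootedRestricted_option]
    simp [not_isRootedRestricted_zero]
  | succ k ih =>
    intro n i
    have h := ncard_isRootedRestricted_congr (finSuccEquiv' i).symm A (k + 1 + 1) none
    rw [finSuccEquiv'_symm_none] at h
    rw [h, ncard_isRootedRestricted_option]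
    cases n with
    | zero => simp
    | succ n => simp [ih, Nat.succ_descFactorial_succ, mul_assoc, -Nat.descFactorial_succ]

lemma isRootedRestricted_iff_of_mem {N : ℕ} {A : Set ℕ} {k : ℕ} (hk : k ∈ A)
    (σ : Equiv.Perm (Fin N)) (i : Fin N) :
    IsRootedRestricted A σ k i ↔ σ ∈ restrictedPerms A N ∧ cycleLength σ i = k := by
  constructor
  · rintro ⟨h1, h2⟩
    refine ⟨fun j => ?_, h1⟩
    by_cases hj : ∀ n : ℕ, σ^[n] i ≠ j
    · exact h2 j hj
    · push Not at hj
      obtain ⟨n, rfl⟩ := hj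
      rw [cycleLength, minimalPeriod_apply_iterate (σ.injective.mem_periodicPts i), h1]
      exact hk
  · rintro ⟨h1, h2⟩
    exact ⟨h2, fun j _ => h1 j⟩

lemma ncard_cycleLength_eq {A : Set ℕ} {k : ℕ} (hk : k + 1 ∈ A) (n : ℕ) (i : Fin (n + 1)) :
    ({σ | σ ∈ restrictedPerms A (n + 1) ∧ cycleLength σ i = k + 1} :
      Set (Equiv.Perm (Fin (n + 1)))).ncard = n.descFactorial k * restrictedCount A (n - k) := by
  rw [← ncard_isRootedRestricted A k n i]
  simp only [isRootedRestricted_iff_of_mem hk]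

open Classical in
lemma restrictedCount_succ (A : Set ℕ) (n : ℕ) :
    restrictedCount A (n + 1) = ∑ k ∈ Finset.range (n + 1),
      if k + 1 ∈ A then n.descFactorial k * restrictedCount A (n - k) else 0 := by
  have hsum : ∀ σ : Equiv.Perm (Fin (n + 1)),
      (if σ ∈ restrictedPerms A (n + 1) then 1 else 0) = ∑ k ∈ Finset.range (n + 1),
        if σ ∈ restrictedPerms A (n + 1) ∧ cycleLength σ 0 = k + 1 then 1 else 0 := by
    intro σ
    by_cases h : σ ∈ restrictedPerms A (n + 1)
    · have h1 : 0 < cycleLength σ 0 :=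
        minimalPeriod_pos_of_mem_periodicPts (σ.injective.mem_periodicPts 0)
      have h2 : cycleLength σ 0 ≤ n + 1 := by
        simpa using! minimalPeriod_le_card (f := σ) (x := (0 : Fin (n + 1)))
      obtain ⟨m, hm⟩ : ∃ m, cycleLength σ 0 = m + 1 := ⟨_, (Nat.sub_add_cancel h1).symm⟩
      simp only [h, hm, true_and, if_true, add_left_inj]
      rw [Finset.sum_ite_eq, if_pos (Finset.mem_range.2 (by omega))]
    · simp [h]
  rw [restrictedCount, ← Set.ofPred_mem_eq (s := restrictedPerms A (n + 1)), ncard_setOf_eq_sum,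
    Finset.sum_congr rfl fun σ _ => hsum σ, Finset.sum_comm]
  refine Finset.sum_congr rfl fun k _ => ?_
  rw [← ncard_setOf_eq_sum]
  split_ifs with hk
  · exact ncard_cycleLength_eq hk n 0
  · rw [Set.ncard_eq_zero]
    ext σ
    simp only [Set.mem_ofPred_eq, Set.mem_empty_iff_false, iff_false, not_and]
    intro h1 h2
    exact hk (h2 ▸ h1 0)

lemma restrictedCount_zero (A : Set ℕ) : restrictedCount A 0 = 1 := by
  have : restrictedPerms A 0 = Set.univ := by
    ext σ; simp [restrictedPerms]
  rw [restrictedCount, this, Set.ncard_univ]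
  simp

end Combinatorics

/-! ### The density of restricted permutations and its recurrence -/

/-- The proportion of permutations of `n` points that have all cycle lengths in `A`. -/
noncomputable def restrictedDensity (A : Set ℕ) (n : ℕ) : ℝ :=
  restrictedCount A n / n.factorial

lemma restrictedDensity_nonneg (A : Set ℕ) (n : ℕ) : 0 ≤ restrictedDensity A n := by
  unfold restrictedDensity; positivity

lemma restrictedDensity_zero (A : Set ℕ) : restrictedDensity A 0 = 1 := by
  simp [restrictedDensity, restrictedCount_zero]

lemma restrictedDensity_ne_zero_iff (A : Set ℕ) (n : ℕ) :
    restrictedDensity A n ≠ 0 ↔ (restrictedPerms A n).Nonempty := by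
  rw [restrictedDensity, Ne, div_eq_zero_iff, not_or, Nat.cast_eq_zero, restrictedCount,
    Set.ncard_eq_zero, Set.nonempty_iff_ne_empty]
  exact and_iff_left (by positivity)

open Classical in
lemma restrictedDensity_succ (A : Set ℕ) (n : ℕ) :
    (n + 1) * restrictedDensity A (n + 1) = ∑ k ∈ Finset.range (n + 1),
      if k + 1 ∈ A then restrictedDensity A (n - k) else 0 := by
  rw [restrictedDensity, restrictedCount_succ, Nat.factorial_succ]
  push_cast
  rw [← mul_div_assoc, mul_div_mul_left _ _ (by positivity), Finset.sum_div]
  refine Finset.sum_congr rfl fun k hk => ?_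
  split_ifs with h
  · rw [restrictedDensity,
      ← Nat.factorial_mul_descFactorial (Nat.lt_succ_iff.1 (Finset.mem_range.1 hk))]
    have : n.descFactorial k ≠ 0 := by
      rw [Ne, Nat.descFactorial_eq_zero_iff_lt]
      have := Finset.mem_range.1 hk
      omega
    push_cast
    field_simp
  · simp

/-- If `A` and `A'` have the same elements up to `n`, the densities agree at `n`. -/
lemma restrictedDensity_congr {A A' : Set ℕ} (n : ℕ) (h : ∀ j ≤ n, j ∈ A ↔ j ∈ A') :
    restrictedDensity A n = restrictedDensity A' n := by
  have hset : restrictedPerms A n = restrictedPerms A' n := by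
    ext σ
    refine forall_congr' fun i => h _ ?_
    simpa using! Function.minimalPeriod_le_card (f := σ) (x := i)
  rw [restrictedDensity, restrictedDensity, restrictedCount, restrictedCount, hset]

lemma cycleProb_eq {A : Set ℕ} {k N : ℕ} (hk : k ∈ A) (hk0 : 0 < k) (hkN : k ≤ N) (i : Fin N) :
    cycleProb A k N i = restrictedDensity A (N - k) / (N * restrictedDensity A N) := by
  obtain ⟨m, rfl⟩ : ∃ m, k = m + 1 := ⟨k - 1, by omega⟩
  obtain ⟨n, rfl⟩ : ∃ n, N = n + 1 := ⟨N - 1, by omega⟩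
  rw [cycleProb, ncard_cycleLength_eq hk, ← restrictedCount, restrictedDensity, restrictedDensity,
    Nat.factorial_succ, Nat.add_sub_add_right,
    ← Nat.factorial_mul_descFactorial (show m ≤ n by omega)]
  have : n.descFactorial m ≠ 0 := by
    rw [Ne, Nat.descFactorial_eq_zero_iff_lt]; omega
  by_cases h0 : restrictedCount A (n + 1) = 0
  · simp [h0]
  push_cast
  field_simp

/-! ### The generating function of a finite set of cycle lengths -/

section Entire

variable {A : Finset ℕ}

/-- The polynomial `∑_{j ∈ A} z ^ j / j` of which the exponential is the generating function of
`restrictedDensity A`. -/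
noncomputable def cycleExponent (A : Finset ℕ) (z : ℂ) : ℂ := ∑ j ∈ A, z ^ j / j

lemma hasDerivAt_cycleExponent (hA : ∀ j ∈ A, 0 < j) (z : ℂ) :
    HasDerivAt (cycleExponent A) (∑ j ∈ A, z ^ (j - 1)) z := by
  unfold cycleExponent
  refine HasDerivAt.fun_sum fun j hj => ?_
  have hj0 : (j : ℂ) ≠ 0 := by exact_mod_cast (hA j hj).ne'
  have := (hasDerivAt_pow j z).div_const (j : ℂ)
  rwa [mul_div_cancel_left₀ _ hj0] at this

/-- The Taylor coefficients of the exponential satisfy the recurrence of `restrictedDensity`,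
because `f' = (∑_{j ∈ A} z ^ (j - 1)) f`. -/
lemma iteratedDeriv_exp_cycleExponent (hA : ∀ j ∈ A, 0 < j) (n : ℕ) :
    iteratedDeriv n (fun z => Complex.exp (cycleExponent A z)) 0 =
      n.factorial * (restrictedDensity (A : Set ℕ) n : ℂ) := by
  classical
  set f : ℂ → ℂ := fun z => Complex.exp (cycleExponent A z) with hf
  have hd : deriv f = fun z => (∑ j ∈ A, z ^ (j - 1)) * f z := by
    ext z
    rw [((hasDerivAt_cycleExponent hA z).cexp).deriv, mul_comm]
  have hQ : ∀ i : ℕ, iteratedDeriv i (fun z : ℂ => ∑ j ∈ A, z ^ (j - 1)) 0 =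
      if i + 1 ∈ A then (i.factorial : ℂ) else 0 := by
    intro i
    rw [iteratedDeriv_fun_sum fun j _ => by fun_prop]
    have hterm : ∀ j ∈ A, iteratedDeriv i (fun z : ℂ => z ^ (j - 1)) 0 =
        if i + 1 = j then (i.factorial : ℂ) else 0 := by
      intro j hj
      rw [iteratedDeriv_fun_pow_zero]
      have := hA j hj
      by_cases h : i + 1 = j
      · subst h; simp
      · rw [if_neg (by omega), if_neg h, Nat.cast_zero]
    rw [Finset.sum_congr rfl hterm, Finset.sum_ite_eq]
  have hfd : ContDiff ℂ ⊤ f := by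
    rw [hf]; unfold cycleExponent; fun_prop
  induction n using Nat.strong_induction_on with
  | _ n ih =>
    cases n with
    | zero =>
      have : cycleExponent A 0 = 0 :=
        Finset.sum_eq_zero fun j hj => by simp [(hA j hj).ne']
      simp [hf, this, restrictedDensity_zero]
    | succ n =>
      rw [iteratedDeriv_succ', hd,
        iteratedDeriv_fun_mul (by fun_prop) (hfd.contDiffAt.of_le (by exact_mod_cast le_top))]
      have hrec := congrArg (fun x : ℝ => (n.factorial : ℂ) * (x : ℂ))
        (restrictedDensity_succ (A : Set ℕ) n)
      simp only [Nat.factorial_succ] at hrec ⊢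
      push_cast at hrec ⊢
      rw [mul_comm ((n : ℂ) + 1), mul_assoc, hrec, Finset.mul_sum]
      refine Finset.sum_congr rfl fun i hi => ?_
      have hin : i ≤ n := Nat.lt_succ_iff.1 (Finset.mem_range.1 hi)
      rw [hQ, ih (n - i) (by omega)]
      by_cases h : i + 1 ∈ A
      · rw [if_pos h, if_pos (by exact_mod_cast h), ← Nat.choose_mul_factorial_mul_factorial hin]
        push_cast
        ring
      · rw [if_neg h, if_neg (by exact_mod_cast h)]
        simp

lemma hasSum_restrictedDensity (hA : ∀ j ∈ A, 0 < j) (z : ℂ) :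
    HasSum (fun n => (restrictedDensity (A : Set ℕ) n : ℂ) * z ^ n)
      (Complex.exp (cycleExponent A z)) := by
  have hdiff : Differentiable ℂ fun z => Complex.exp (cycleExponent A z) := fun z =>
    (hasDerivAt_cycleExponent hA z).cexp.differentiableAt
  refine Eq.subst (motive := fun g => HasSum g _) (funext fun n => ?_)
    (Complex.hasSum_taylorSeries_of_entire hdiff 0 z)
  rw [iteratedDeriv_exp_cycleExponent hA]
  have : (n.factorial : ℂ) ≠ 0 := by exact_mod_cast n.factorial_ne_zero
  simp only [sub_zero, smul_eq_mul]
  field_simp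

lemma hasSum_restrictedDensity_one (hA : ∀ j ∈ A, 0 < j) :
    HasSum (restrictedDensity (A : Set ℕ)) (Real.exp (∑ j ∈ A, 1 / (j : ℝ))) := by
  have h := hasSum_restrictedDensity hA 1
  rw [← Complex.hasSum_ofReal]
  simpa [cycleExponent] using h

end Entire

/-! ### Cycle lengths with summable complement -/

section Cofinite

open PowerSeries

lemma summable_restrictedDensity {B : Set ℕ} (hB : ∀ b ∈ B, 0 < b)
    (hs : Summable fun j : B => 1 / ((j : ℕ) : ℝ)) : Summable (restrictedDensity B) := by
  classical
  have hs' : Summable (B.indicator fun j : ℕ => 1 / (j : ℝ)) :=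
    summable_subtype_iff_indicator.1 hs
  refine summable_of_sum_range_le (restrictedDensity_nonneg B)
    (c := Real.exp (∑' j, B.indicator (fun j : ℕ => 1 / (j : ℝ)) j)) fun M => ?_
  -- Only the lengths below `M` matter for the first `M` terms.
  set BM : Finset ℕ := (Finset.range M).filter (· ∈ B) with hBM
  have hpos : ∀ j ∈ BM, 0 < j := fun j hj => hB j (Finset.mem_filter.1 hj).2
  have hcongr : ∑ n ∈ Finset.range M, restrictedDensity B n =
      ∑ n ∈ Finset.range M, restrictedDensity (BM : Set ℕ) n := by
    refine Finset.sum_congr rfl fun n hn => restrictedDensity_congr n fun j hj => ?_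
    have := Finset.mem_range.1 hn
    simp only [hBM, Finset.coe_filter, Finset.mem_range, Set.mem_ofPred_eq]
    exact ⟨fun h => ⟨by omega, h⟩, fun h => h.2⟩
  rw [hcongr]
  refine (sum_le_hasSum _ (fun n _ => restrictedDensity_nonneg _ n)
    (hasSum_restrictedDensity_one hpos)).trans (Real.exp_le_exp.2 ?_)
  have : ∑ j ∈ BM, 1 / (j : ℝ) =
      ∑ j ∈ Finset.range M, B.indicator (fun j : ℕ => 1 / (j : ℝ)) j := by
    rw [hBM, Finset.sum_filter]
    exact Finset.sum_congr rfl fun j _ => by simp [Set.indicator_apply]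
  rw [this]
  exact hs'.sum_le_tsum _ fun j _ => Set.indicator_nonneg (fun _ _ => by positivity) j

open Classical in
/-- The power series `∑_{j ∈ A, j ≥ 1} X ^ (j - 1)`. -/
noncomputable def lengthSeries (A : Set ℕ) : PowerSeries ℝ :=
  PowerSeries.mk fun n => if n + 1 ∈ A then 1 else 0

/-- The generating series of `restrictedDensity A`. -/
noncomputable def densitySeries (A : Set ℕ) : PowerSeries ℝ :=
  PowerSeries.mk (restrictedDensity A)

lemma derivative_densitySeries (A : Set ℕ) :
    PowerSeries.derivative ℝ (densitySeries A) = lengthSeries A * densitySeries A := by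
  classical
  ext n
  rw [PowerSeries.coeff_derivative, PowerSeries.coeff_mul, densitySeries, PowerSeries.coeff_mk,
    mul_comm, restrictedDensity_succ, Finset.Nat.sum_antidiagonal_eq_sum_range_succ
      (fun i j => coeff i (lengthSeries A) * coeff j (PowerSeries.mk (restrictedDensity A)))]
  refine Finset.sum_congr rfl fun k _ => ?_
  simp only [lengthSeries, coeff_mk]
  split_ifs <;> simp

lemma constantCoeff_densitySeries (A : Set ℕ) :
    PowerSeries.constantCoeff (densitySeries A) = 1 := by
  rw [← PowerSeries.coeff_zero_eq_constantCoeff_apply, densitySeries, coeff_mk,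
    restrictedDensity_zero]

lemma one_sub_X_mul_lengthSeries_add (A B : Set ℕ) (hAB : ∀ j, 0 < j → (j ∈ B ↔ j ∉ A)) :
    (1 - X) * (lengthSeries A + lengthSeries B) = 1 := by
  have : lengthSeries A + lengthSeries B = PowerSeries.mk 1 := by
    ext n
    simp only [lengthSeries, map_add, coeff_mk, hAB (n + 1) n.succ_pos]
    split_ifs <;> simp_all
  rw [this, mul_comm, PowerSeries.mk_one_mul_one_sub_eq_one ℝ]

lemma derivative_one_sub_X_mul (A B : Set ℕ) (hAB : ∀ j, 0 < j → (j ∈ B ↔ j ∉ A)) :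
    PowerSeries.derivative ℝ ((1 - X) * densitySeries A) =
      -lengthSeries B * ((1 - X) * densitySeries A) := by
  rw [Derivation.leibniz, derivative_densitySeries, map_sub, PowerSeries.derivative_X]
  simp only [smul_eq_mul, Derivation.map_one_eq_zero]
  linear_combination densitySeries A * one_sub_X_mul_lengthSeries_add A B hAB

lemma one_sub_X_mul_densitySeries_mul (A B : Set ℕ) (hAB : ∀ j, 0 < j → (j ∈ B ↔ j ∉ A)) :
    (1 - X) * densitySeries A * densitySeries B = 1 := by
  refine PowerSeries.derivative.ext ?_ ?_
  · rw [Derivation.leibniz, derivative_one_sub_X_mul A B hAB, derivative_densitySeries]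
    simp only [smul_eq_mul, Derivation.map_one_eq_zero]
    ring
  · simp [constantCoeff_densitySeries]

/-- The increments of `restrictedDensity A` are dominated by `restrictedDensity B`, as both satisfy
the recurrence with weights on `B`, up to a sign. -/
lemma abs_coeff_one_sub_X_mul_le (A B : Set ℕ) (hAB : ∀ j, 0 < j → (j ∈ B ↔ j ∉ A)) (n : ℕ) :
    |coeff n ((1 - X) * densitySeries A)| ≤ restrictedDensity B n := by
  classical
  induction n using Nat.strong_induction_on with
  | _ n ih =>
    cases n with
    | zero =>
      rw [coeff_zero_eq_constantCoeff_apply, map_mul, constantCoeff_densitySeries,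
        restrictedDensity_zero]
      simp
    | succ n =>
      have h := congrArg (coeff n) (derivative_one_sub_X_mul A B hAB)
      rw [PowerSeries.coeff_derivative, neg_mul, map_neg,
        PowerSeries.coeff_mul n (lengthSeries B),
        Finset.Nat.sum_antidiagonal_eq_sum_range_succ
          (fun i j => coeff i (lengthSeries B) * coeff j ((1 - X) * densitySeries A))] at h
      have hn : (0 : ℝ) < n + 1 := by positivity
      refine le_of_mul_le_mul_left ?_ hn
      rw [restrictedDensity_succ]
      calc ((n : ℝ) + 1) * |coeff (n + 1) ((1 - X) * densitySeries A)|
          = |coeff (n + 1) ((1 - X) * densitySeries A) * ((n : ℝ) + 1)| := by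
            rw [abs_mul, abs_of_pos hn, mul_comm]
        _ ≤ _ := by
            rw [h, abs_neg]
            refine (Finset.abs_sum_le_sum_abs _ _).trans (Finset.sum_le_sum fun k hk => ?_)
            rw [lengthSeries, coeff_mk]
            split_ifs
            · rw [one_mul]
              exact ih (n - k) (by omega)
            · simp

/-- The density converges to a positive limit when the reciprocals of the excluded lengths are
summable. -/
lemma exists_tendsto_restrictedDensity {A B : Set ℕ} (hB : ∀ b ∈ B, 0 < b)
    (hAB : ∀ j, 0 < j → (j ∈ B ↔ j ∉ A)) (hs : Summable fun j : B => 1 / ((j : ℕ) : ℝ)) :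
    ∃ L : ℝ, L ≠ 0 ∧ Tendsto (restrictedDensity A) atTop (nhds L) := by
  set b : ℕ → ℝ := fun n => coeff n ((1 - X) * densitySeries A) with hb
  have hβ := summable_restrictedDensity hB hs
  have hbs : Summable fun n => ‖b n‖ :=
    Summable.of_nonneg_of_le (fun n => norm_nonneg _) (abs_coeff_one_sub_X_mul_le A B hAB) hβ
  have hβn : Summable fun n => ‖restrictedDensity B n‖ := hβ.norm
  refine ⟨∑' n, b n, ?_, ?_⟩
  · have h := tsum_mul_tsum_eq_tsum_sum_antidiagonal_of_summable_norm hbs hβn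
    have hc : ∀ n, ∑ kl ∈ Finset.HasAntidiagonal.antidiagonal n, b kl.1 * restrictedDensity B kl.2 =
        if n = 0 then 1 else 0 := by
      intro n
      rw [← coeff_one, ← one_sub_X_mul_densitySeries_mul A B hAB, PowerSeries.coeff_mul]
      simp [hb, densitySeries]
    rw [tsum_congr hc, tsum_ite_eq] at h
    exact left_ne_zero_of_mul (h ▸ one_ne_zero)
  · have hsum : ∀ n, ∑ m ∈ Finset.range (n + 1), b m = restrictedDensity A n := by
      intro n
      induction n with
      | zero => simp [hb, constantCoeff_densitySeries, restrictedDensity_zero]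
      | succ n ih =>
        rw [Finset.sum_range_succ, ih, hb]
        simp [sub_mul, densitySeries, coeff_succ_X_mul]
    have ht := (tendsto_add_atTop_iff_nat 1).2 hbs.of_norm.hasSum.tendsto_sum_nat
    exact ht.congr hsum

lemma tendsto_restrictedDensity_sub_div {A B : Set ℕ} (hB : ∀ b ∈ B, 0 < b)
    (hAB : ∀ j, 0 < j → (j ∈ B ↔ j ∉ A)) (hs : Summable fun j : B => 1 / ((j : ℕ) : ℝ)) (k : ℕ) :
    Tendsto (fun N => restrictedDensity A (N - k) / restrictedDensity A N) atTop (nhds 1) := by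
  obtain ⟨L, hL, h⟩ := exists_tendsto_restrictedDensity hB hAB hs
  have := (h.comp (tendsto_sub_atTop_nat k)).div h hL
  rwa [div_self hL] at this

end Cofinite

/-! ### Coefficients as Fourier integrals -/

section Fourier

variable {A : Finset ℕ}

lemma dvd_of_restrictedDensity_ne_zero (n : ℕ) (h : restrictedDensity (A : Set ℕ) n ≠ 0) :
    A.gcd id ∣ n := by
  classical
  induction n using Nat.strong_induction_on with
  | _ n ih =>
    cases n with
    | zero => exact dvd_zero _
    | succ n =>
      have h1 : ((n : ℝ) + 1) * restrictedDensity (A : Set ℕ) (n + 1) ≠ 0 :=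
        mul_ne_zero (by positivity) h
      rw [restrictedDensity_succ] at h1
      obtain ⟨k, hk, hne⟩ := Finset.exists_ne_zero_of_sum_ne_zero h1
      have hkn := Finset.mem_range.1 hk
      split_ifs at hne with hkA
      · have h2 := ih (n - k) (by omega) hne
        have h3 : A.gcd id ∣ k + 1 := Finset.gcd_dvd (f := id) (by exact_mod_cast hkA)
        have := dvd_add h2 h3
        rwa [show n - k + (k + 1) = n + 1 by omega] at this
      · exact absurd rfl hne

/-- Bézout's identity for a finite set, in terms of subgroups of `ℤ`. -/
lemma gcd_mem_of_forall_mem (H : AddSubgroup ℤ) (h : ∀ j ∈ A, (j : ℤ) ∈ H) :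
    ((A.gcd id : ℕ) : ℤ) ∈ H := by
  obtain ⟨a, rfl⟩ := Int.subgroup_cyclic H
  simp only [← AddSubgroup.zmultiples_eq_closure, Int.mem_zmultiples_iff] at h ⊢
  have : a.natAbs ∣ A.gcd id := Finset.dvd_gcd fun j hj => Int.natAbs_dvd_natAbs.2 (h j hj)
  exact Int.natAbs_dvd.1 (by exact_mod_cast this)

lemma gcd_pos_of_mem (hA : ∀ j ∈ A, 0 < j) {d : ℕ} (hd : d ∈ A) : 0 < A.gcd id :=
  Nat.pos_of_dvd_of_pos (Finset.gcd_dvd (f := id) hd) (hA d hd)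

lemma integral_exp_int_mul_eq_zero {g : ℕ} (hg : 0 < g) {l : ℤ} (hl : l ≠ 0) :
    ∫ θ : ℝ in -(Real.pi / g)..Real.pi / g, Complex.exp ((g * l : ℂ) * Complex.I * θ) = 0 := by
  have hg0 : (g : ℂ) ≠ 0 := by exact_mod_cast hg.ne'
  have hl0 : (l : ℂ) ≠ 0 := by exact_mod_cast hl
  rw [integral_exp_mul_complex (by simp [hg0, hl0])]
  rw [div_eq_zero_iff, sub_eq_zero]
  left
  rw [Complex.exp_eq_exp_iff_exists_int]
  refine ⟨l, ?_⟩
  push_cast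
  field_simp
  ring

/-- Cauchy's coefficient formula on the circle of radius `r`, for an index divisible by `gcd A`.
Since only such coefficients are nonzero, the integral may be taken over one period
`[-π / gcd A, π / gcd A]`, on which the integrand has a single peak. -/
lemma integral_exp_cycleExponent (hA : ∀ j ∈ A, 0 < j) (hg : 0 < A.gcd id) (r : ℝ) {n : ℕ}
    (hn : A.gcd id ∣ n) :
    ∫ θ : ℝ in -(Real.pi / (A.gcd id : ℕ))..Real.pi / (A.gcd id : ℕ),
      Complex.exp (cycleExponent A (r * Complex.exp (θ * Complex.I))) *
        Complex.exp (-(n * θ) * Complex.I) =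
      2 * Real.pi / (A.gcd id : ℕ) * (restrictedDensity (A : Set ℕ) n * r ^ n) := by
  set g := A.gcd id with hgdef
  set a : ℕ → ℝ := restrictedDensity (A : Set ℕ) with ha
  set F : ℕ → ℝ → ℂ := fun m θ =>
    a m * (r * Complex.exp (θ * Complex.I)) ^ m * Complex.exp (-(n * θ) * Complex.I) with hF
  have hFexp : ∀ m θ, F m θ =
      (a m * r ^ m) * Complex.exp (((m : ℂ) - n) * Complex.I * θ) := by
    intro m θ
    simp only [hF, mul_pow, ← Complex.exp_nat_mul]
    rw [← mul_assoc, mul_assoc _ (Complex.exp _), ← Complex.exp_add]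
    congr 2
    ring
  have hsumm : Summable fun m => a m * |r| ^ m := by
    have := (hasSum_restrictedDensity hA ((|r| : ℝ) : ℂ)).summable.norm
    refine this.congr fun m => ?_
    rw [norm_mul, norm_pow, Complex.norm_real, Complex.norm_real, Real.norm_eq_abs,
      Real.norm_eq_abs, abs_abs, abs_of_nonneg (restrictedDensity_nonneg _ _)]
  have hsum := intervalIntegral.hasSum_integral_of_dominated_convergence
    (μ := MeasureTheory.volume) (a := -(Real.pi / g)) (b := Real.pi / g) (F := F)
    (f := fun θ : ℝ => Complex.exp (cycleExponent A (r * Complex.exp (θ * Complex.I))) *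
        Complex.exp (-(n * θ) * Complex.I))
    (fun m _ => a m * |r| ^ m)
    (fun m => by
      refine Continuous.aestronglyMeasurable ?_
      rw [hF]; fun_prop)
    (fun m => Eventually.of_forall fun θ _ => by
      have h1 : ‖Complex.exp (((m : ℂ) - n) * Complex.I * θ)‖ = 1 := by
        rw [Complex.norm_exp]; simp
      rw [hFexp, norm_mul, h1, mul_one, norm_mul, norm_pow, Complex.norm_real, Complex.norm_real,
        Real.norm_eq_abs, Real.norm_eq_abs, abs_of_nonneg (restrictedDensity_nonneg _ _)])
    (Eventually.of_forall fun θ _ => hsumm)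
    (by simp)
    (Eventually.of_forall fun θ _ =>
      (hasSum_restrictedDensity hA (r * Complex.exp (θ * Complex.I))).mul_right _)
  refine hsum.unique ?_
  have hint : ∀ m, m ≠ n → ∫ θ : ℝ in -(Real.pi / g)..Real.pi / g, F m θ = 0 := by
    intro m hm
    simp only [hFexp]
    rw [intervalIntegral.integral_const_mul]
    by_cases h0 : a m = 0
    · simp [h0]
    have hgm : (g : ℤ) ∣ (m : ℤ) - n :=
      dvd_sub (by exact_mod_cast dvd_of_restrictedDensity_ne_zero m h0) (by exact_mod_cast hn)
    obtain ⟨l, hl⟩ := hgm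
    have hl0 : l ≠ 0 := by
      rintro rfl
      apply hm
      have : (m : ℤ) - n = 0 := by simpa using hl
      omega
    have hlc : (m : ℂ) - n = g * l := by exact_mod_cast congrArg (Int.cast : ℤ → ℂ) hl
    rw [hlc, integral_exp_int_mul_eq_zero hg hl0, mul_zero]
  have hval : ∫ θ : ℝ in -(Real.pi / g)..Real.pi / g, F n θ =
      2 * Real.pi / (g : ℕ) * (a n * r ^ n) := by
    simp only [hFexp]
    simp only [sub_self, zero_mul, Complex.exp_zero, mul_one, intervalIntegral.integral_const]
    rw [Complex.real_smul]
    push_cast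
    ring
  rw [← hval]
  exact hasSum_single n hint

end Fourier

/-! ### The saddle point estimate -/

section Saddle

variable {A : Finset ℕ}

/-- The exponent of the Fourier integrand, after division by its value at `θ = 0` and with the
linear term removed. -/
noncomputable def saddleExponent (A : Finset ℕ) (r θ : ℝ) : ℂ :=
  ∑ j ∈ A, ((r ^ j / j : ℝ) : ℂ) *
    (Complex.exp ((j * θ : ℝ) * Complex.I) - 1 - (j * θ : ℝ) * Complex.I)

lemma saddleExponent_eq (hA : ∀ j ∈ A, 0 < j) (r θ : ℝ) :
    saddleExponent A r θ = cycleExponent A (r * Complex.exp (θ * Complex.I)) - cycleExponent A r -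
      ((∑ j ∈ A, r ^ j : ℝ) * θ : ℝ) * Complex.I := by
  rw [saddleExponent, cycleExponent, cycleExponent, Finset.sum_mul]
  push_cast
  rw [Finset.sum_mul, ← Finset.sum_sub_distrib, ← Finset.sum_sub_distrib]
  refine Finset.sum_congr rfl fun j hj => ?_
  have hj0 : (j : ℂ) ≠ 0 := by exact_mod_cast (hA j hj).ne'
  rw [mul_pow, ← Complex.exp_nat_mul, ← mul_assoc (j : ℂ)]
  field_simp

lemma re_saddleExponent (r θ : ℝ) :
    (saddleExponent A r θ).re = -∑ j ∈ A, r ^ j / j * (1 - Real.cos (j * θ)) := by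
  rw [saddleExponent, Complex.re_sum, ← Finset.sum_neg_distrib]
  refine Finset.sum_congr rfl fun j _ => ?_
  rw [Complex.re_ofReal_mul, Complex.sub_re, Complex.sub_re, Complex.exp_ofReal_mul_I_re]
  simp
  ring

/-- The scale `√(d r ^ d)` of the standard deviation at the saddle point `r`. -/
noncomputable def saddleScale (d : ℕ) (r : ℝ) : ℝ := √(d * r ^ d)

lemma saddleScale_sq {d : ℕ} {r : ℝ} (hr : 0 ≤ r) : saddleScale d r ^ 2 = d * r ^ d :=
  Real.sq_sqrt (by positivity)

lemma saddleScale_pos {d : ℕ} (hd : 0 < d) {r : ℝ} (hr : 0 < r) : 0 < saddleScale d r :=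
  Real.sqrt_pos.2 (by positivity)

lemma tendsto_saddleScale {d : ℕ} (hd : 0 < d) : Tendsto (saddleScale d) atTop atTop :=
  Real.tendsto_sqrt_atTop.comp
    ((tendsto_pow_atTop hd.ne').const_mul_atTop (by exact_mod_cast hd))

/-- On a period, the integrand has its full modulus only at `θ = 0`. -/
lemma sum_one_sub_cos_pos (hA : ∀ j ∈ A, 0 < j) (hg : 0 < A.gcd id) {θ : ℝ} (h0 : θ ≠ 0)
    (hθ : |θ| ≤ Real.pi / (A.gcd id : ℕ)) : 0 < ∑ j ∈ A, (1 - Real.cos (j * θ)) / j := by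
  have hnn : ∀ j ∈ A, 0 ≤ (1 - Real.cos (j * θ)) / j := fun j _ =>
    div_nonneg (sub_nonneg.2 (Real.cos_le_one _)) (Nat.cast_nonneg j)
  refine (Finset.sum_nonneg hnn).lt_of_ne' fun hzero => ?_
  rw [Finset.sum_eq_zero_iff_of_nonneg hnn] at hzero
  -- The multiples of `θ` that are integral multiples of `2π` form a group containing `A`.
  have hmem := gcd_mem_of_forall_mem (A := A)
    ((AddSubgroup.zmultiples (2 * Real.pi)).comap (zmultiplesHom ℝ θ)) (by
      intro j hj
      have hj0 : (j : ℝ) ≠ 0 := by exact_mod_cast (hA j hj).ne'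
      have h1 : Real.cos (j * θ) = 1 := by
        have := (div_eq_zero_iff.1 (hzero j hj)).resolve_right hj0
        linarith
      obtain ⟨m, hm⟩ := (Real.cos_eq_one_iff _).1 h1
      rw [AddSubgroup.mem_comap, AddSubgroup.mem_zmultiples_iff]
      exact ⟨m, by simpa using hm⟩)
  rw [AddSubgroup.mem_comap, AddSubgroup.mem_zmultiples_iff] at hmem
  obtain ⟨m, hm⟩ := hmem
  have hg' : (0 : ℝ) < (A.gcd id : ℕ) := by exact_mod_cast hg
  have hm' : (m : ℝ) * (2 * Real.pi) = (A.gcd id : ℕ) * θ := by simpa using hm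
  have habs : |(m : ℝ)| * (2 * Real.pi) ≤ Real.pi := by
    have h2 : |(m : ℝ) * (2 * Real.pi)| = (A.gcd id : ℕ) * |θ| := by
      rw [hm', abs_mul, abs_of_pos hg']
    rw [abs_mul, abs_of_pos Real.two_pi_pos] at h2
    rw [h2]
    calc _ ≤ ((A.gcd id : ℕ) : ℝ) * (Real.pi / (A.gcd id : ℕ)) := by gcongr
      _ = Real.pi := by field_simp
  have hm0 : m = 0 := by
    by_contra hne
    have h3 : (1 : ℝ) ≤ |(m : ℝ)| := by exact_mod_cast Int.one_le_abs hne
    nlinarith [Real.pi_pos]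
  rw [hm0] at hm'
  simp only [Int.cast_zero, zero_mul] at hm'
  exact (mul_ne_zero hg'.ne' h0) hm'.symm

/-- The integrable bound for dominated convergence: near `0` the leading length `d` gives Gaussian
decay, and on the rest of the period the sum of `1 - cos (j θ)` is bounded below, which gives decay
`exp (-c r)`, smaller than any power of `r`. -/
lemma exists_norm_exp_saddleExponent_le (hA : ∀ j ∈ A, 0 < j) {d : ℕ} (hd : d ∈ A) :
    ∃ K : ℝ, ∀ r t : ℝ, 1 ≤ r → |t| ≤ Real.pi / (A.gcd id : ℕ) * saddleScale d r →
      ‖Complex.exp (saddleExponent A r (t / saddleScale d r))‖ ≤ K * (1 + t ^ 2)⁻¹ := by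
  have hg := gcd_pos_of_mem hA hd
  have hd0 := hA d hd
  have hdR : (0 : ℝ) < d := by exact_mod_cast hd0
  have hpi := Real.pi_pos
  set g := A.gcd id with hgdef
  have hgR : (1 : ℝ) ≤ g := by exact_mod_cast hg
  -- `π / d ≤ |θ| ≤ π / g` is compact and contains no common zero of the `1 - cos (j θ)`.
  obtain ⟨c, hc, hcle⟩ : ∃ c : ℝ, 0 < c ∧
      ∀ θ ∈ Set.Icc (-(Real.pi / g)) (Real.pi / g) ∩ {θ | Real.pi / d ≤ |θ|},
        c ≤ ∑ j ∈ A, (1 - Real.cos (j * θ)) / j := by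
    refine IsCompact.exists_forall_le' ?_ ?_ ?_
    · exact isCompact_Icc.inter_right (isClosed_le continuous_const continuous_abs)
    · exact Continuous.continuousOn (by fun_prop)
    · rintro θ ⟨h1, h2⟩
      refine sum_one_sub_cos_pos hA hg ?_ (abs_le.2 h1)
      rintro rfl
      have : Real.pi / d ≤ 0 := by simpa using h2
      exact absurd this (not_le.2 (by positivity))
  -- `K1` serves near `0`, by `1 + x ≤ exp x`, and `K2` elsewhere, by `x ^ d / d! ≤ exp x`.
  set K1 : ℝ := 1 + Real.pi ^ 2 / 2 with hK1
  set K2 : ℝ := 1 + Real.pi ^ 2 * d * (d.factorial / c ^ d) with hK2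
  have hK1' : 0 ≤ K1 := by positivity
  have hK2' : 0 ≤ K2 := by positivity
  refine ⟨K1 + K2, fun r t hr ht => ?_⟩
  have hr0 : 0 < r := by linarith
  have hs := saddleScale_pos hd0 hr0
  have hs2 : saddleScale d r ^ 2 = d * r ^ d := saddleScale_sq hr0.le
  set s := saddleScale d r with hsdef
  rw [Complex.norm_exp, re_saddleExponent]
  set θ := t / s with hθ
  have hterm : ∀ j ∈ A, 0 ≤ r ^ j / j * (1 - Real.cos (j * θ)) := fun j _ =>
    mul_nonneg (by positivity) (sub_nonneg.2 (Real.cos_le_one _))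
  have ht2 : 0 < 1 + t ^ 2 := by positivity
  rw [← div_eq_mul_inv, le_div_iff₀ ht2]
  have hexp : ∀ x : ℝ, Real.exp (-x) = 1 / Real.exp x := fun x => by
    rw [Real.exp_neg, one_div]
  by_cases hnear : |θ| ≤ Real.pi / d
  · have hx : |(d : ℝ) * θ| ≤ Real.pi := by
      rw [abs_mul, abs_of_pos hdR]
      calc (d : ℝ) * |θ| ≤ d * (Real.pi / d) := by gcongr
        _ = Real.pi := by field_simp
    have hcos := Real.cos_le_one_sub_mul_cos_sq hx
    have hlow : 2 / Real.pi ^ 2 * t ^ 2 ≤ ∑ j ∈ A, r ^ j / j * (1 - Real.cos (j * θ)) := by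
      refine le_trans ?_ (Finset.single_le_sum hterm hd)
      have h1 : 2 / Real.pi ^ 2 * (d * θ) ^ 2 ≤ 1 - Real.cos (d * θ) := by linarith
      calc 2 / Real.pi ^ 2 * t ^ 2 = r ^ d / d * (2 / Real.pi ^ 2 * (d * θ) ^ 2) := by
            have : t ^ 2 = θ ^ 2 * (d * r ^ d) := by
              rw [← hs2, hθ]; field_simp
            rw [this]; field_simp
        _ ≤ _ := by gcongr
    have hle : 1 + t ^ 2 ≤ K1 * Real.exp (∑ j ∈ A, r ^ j / j * (1 - Real.cos (j * θ))) := by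
      have h1 := Real.add_one_le_exp (2 / Real.pi ^ 2 * t ^ 2)
      calc 1 + t ^ 2 ≤ K1 * (2 / Real.pi ^ 2 * t ^ 2 + 1) := by
            have : K1 * (2 / Real.pi ^ 2 * t ^ 2 + 1) =
                1 + t ^ 2 + (2 / Real.pi ^ 2 * t ^ 2 + Real.pi ^ 2 / 2) := by
              rw [hK1]; field_simp; ring
            rw [this]
            have : 0 ≤ 2 / Real.pi ^ 2 * t ^ 2 + Real.pi ^ 2 / 2 := by positivity
            linarith
        _ ≤ _ := by
            gcongr
            exact h1.trans (Real.exp_le_exp.2 hlow)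
    rw [hexp, div_mul_eq_mul_div, one_mul, div_le_iff₀ (Real.exp_pos _)]
    refine hle.trans ?_
    gcongr
    linarith
  · have hθle : |θ| ≤ Real.pi / g := by
      rw [hθ, abs_div, abs_of_pos hs, div_le_iff₀ hs]; exact ht
    have hlow : c * r ≤ ∑ j ∈ A, r ^ j / j * (1 - Real.cos (j * θ)) := by
      have h1 := hcle θ ⟨abs_le.1 hθle, (not_le.1 hnear).le⟩
      calc c * r ≤ (∑ j ∈ A, (1 - Real.cos (j * θ)) / j) * r := by gcongr
        _ = ∑ j ∈ A, r / j * (1 - Real.cos (j * θ)) := by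
            rw [Finset.sum_mul]
            exact Finset.sum_congr rfl fun j _ => by ring
        _ ≤ _ := by
            refine Finset.sum_le_sum fun j hj => ?_
            have h2 : 0 ≤ 1 - Real.cos (j * θ) := sub_nonneg.2 (Real.cos_le_one _)
            have h3 : r ≤ r ^ j := le_self_pow₀ hr (hA j hj).ne'
            gcongr
    have hle : 1 + t ^ 2 ≤ K2 * Real.exp (∑ j ∈ A, r ^ j / j * (1 - Real.cos (j * θ))) := by
      have h1 := (Real.pow_div_factorial_le_exp (c * r) (by positivity) d).trans
        (Real.exp_le_exp.2 hlow)
      set E := Real.exp (∑ j ∈ A, r ^ j / j * (1 - Real.cos (j * θ))) with hE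
      have hE1 : 1 ≤ E := Real.one_le_exp (Finset.sum_nonneg hterm)
      have h2 : t ^ 2 ≤ Real.pi ^ 2 * (d * r ^ d) := by
        rw [← hs2, ← mul_pow, ← sq_abs t]
        refine pow_le_pow_left₀ (abs_nonneg t) (ht.trans ?_) 2
        gcongr
        exact div_le_self hpi.le hgR
      have h3 : r ^ d ≤ d.factorial / c ^ d * E := by
        rw [div_mul_eq_mul_div, le_div_iff₀ (by positivity)]
        rw [div_le_iff₀ (by positivity), mul_pow] at h1
        linarith
      calc 1 + t ^ 2 ≤ E + Real.pi ^ 2 * (d * (d.factorial / c ^ d * E)) := by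
            refine add_le_add hE1 (h2.trans ?_)
            gcongr
        _ = K2 * E := by rw [hK2]; ring
    rw [hexp, div_mul_eq_mul_div, one_mul, div_le_iff₀ (Real.exp_pos _)]
    refine hle.trans ?_
    gcongr
    linarith

lemma tendsto_pow_div_saddleScale_sq {d j : ℕ} (hd : 0 < d) (hj : j ≤ d) :
    Tendsto (fun r => r ^ j / saddleScale d r ^ 2) atTop
      (nhds (if j = d then 1 / (d : ℝ) else 0)) := by
  have hdR : (d : ℝ) ≠ 0 := by exact_mod_cast hd.ne'
  split_ifs with h
  · subst h
    refine tendsto_const_nhds.congr' ?_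
    filter_upwards [eventually_gt_atTop 0] with r hr
    rw [saddleScale_sq hr.le]
    field_simp
  · have := (tendsto_pow_div_pow_atTop_zero (𝕜 := ℝ) (lt_of_le_of_ne hj h)).const_mul (1 / (d : ℝ))
    rw [mul_zero] at this
    refine this.congr' ?_
    filter_upwards [eventually_gt_atTop 0] with r hr
    rw [saddleScale_sq hr.le]
    field_simp

lemma norm_exp_mul_I_sub_le {x : ℝ} (hx : |x| ≤ 1) :
    ‖Complex.exp (x * Complex.I) - 1 - x * Complex.I + (x ^ 2 / 2 : ℝ)‖ ≤ |x| ^ 3 := by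
  have hn : ‖(x : ℂ) * Complex.I‖ = |x| := by simp
  have h := Complex.exp_bound (x := x * Complex.I) (hn ▸ hx) (n := 3) (by norm_num)
  rw [hn] at h
  have he : Complex.exp (x * Complex.I) - ∑ m ∈ Finset.range 3, (x * Complex.I) ^ m / m.factorial =
      Complex.exp (x * Complex.I) - 1 - x * Complex.I + (x ^ 2 / 2 : ℝ) := by
    simp only [Finset.sum_range_succ, Finset.sum_range_zero, mul_pow, Complex.I_sq]
    push_cast
    simp [Nat.factorial]
    ring
  rw [he] at h
  refine h.trans (mul_le_of_le_one_right (by positivity) ?_)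
  norm_num [Nat.factorial]

lemma tendsto_saddleExponent (hA : ∀ j ∈ A, 0 < j) {d : ℕ} (hd : d ∈ A)
    (hmax : ∀ j ∈ A, j ≤ d) (t : ℝ) :
    Tendsto (fun r => saddleExponent A r (t / saddleScale d r)) atTop
      (nhds ((-(t ^ 2 / 2) : ℝ) : ℂ)) := by
  classical
  have hd0 := hA d hd
  have hinv : Tendsto (fun r => (saddleScale d r)⁻¹) atTop (nhds 0) :=
    tendsto_inv_atTop_zero.comp (tendsto_saddleScale hd0)
  have hsum : ((-(t ^ 2 / 2) : ℝ) : ℂ) =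
      ∑ j ∈ A, (if j = d then ((-(t ^ 2 / 2) : ℝ) : ℂ) else 0) := by
    rw [Finset.sum_ite_eq', if_pos hd]
  rw [hsum]
  refine tendsto_finsetSum A fun j hj => ?_
  have hj0 : (j : ℝ) ≠ 0 := by exact_mod_cast (hA j hj).ne'
  have hρ := tendsto_pow_div_saddleScale_sq hd0 (hmax j hj)
  -- The quadratic part of the term survives only for `j = d`.
  have hquad : Tendsto (fun r => ((r ^ j / j * ((j * (t / saddleScale d r)) ^ 2 / 2) : ℝ) : ℂ))
      atTop (nhds (if j = d then ((t ^ 2 / 2 : ℝ) : ℂ) else 0)) := by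
    have h1 : Tendsto (fun r => r ^ j / j * ((j * (t / saddleScale d r)) ^ 2 / 2)) atTop
        (nhds (if j = d then t ^ 2 / 2 else 0)) := by
      have h2 := hρ.const_mul (j * t ^ 2 / 2)
      have h3 : (j * t ^ 2 / 2) * (if j = d then 1 / (d : ℝ) else 0) =
          if j = d then t ^ 2 / 2 else 0 := by
        split_ifs with h
        · subst h; field_simp
        · simp
      rw [h3] at h2
      refine h2.congr' ?_
      filter_upwards [eventually_gt_atTop 0] with r hr
      have := (saddleScale_pos hd0 hr).ne'
      field_simp
    have h4 := (Complex.continuous_ofReal.tendsto _).comp h1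
    simpa [Function.comp_def, apply_ite (Complex.ofReal)] using h4
  -- The remainder is of third order in `t / √(d r ^ d)`.
  have hrem : Tendsto (fun r => ((r ^ j / j : ℝ) : ℂ) *
      (Complex.exp ((j * (t / saddleScale d r) : ℝ) * Complex.I) - 1 -
        (j * (t / saddleScale d r) : ℝ) * Complex.I +
          ((j * (t / saddleScale d r)) ^ 2 / 2 : ℝ))) atTop (nhds 0) := by
    have hb : Tendsto (fun r => j ^ 2 * |t| ^ 3 * ((r ^ j / saddleScale d r ^ 2) *
        (saddleScale d r)⁻¹)) atTop (nhds 0) := by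
      have := (hρ.mul hinv).const_mul ((j : ℝ) ^ 2 * |t| ^ 3)
      simpa using this
    refine squeeze_zero_norm' ?_ hb
    have hsmall : Tendsto (fun r => |(j : ℝ) * (t / saddleScale d r)|) atTop (nhds 0) := by
      have := ((hinv.const_mul t).const_mul (j : ℝ)).abs
      simpa [div_eq_mul_inv] using this
    filter_upwards [eventually_gt_atTop 0, hsmall.eventually (ge_mem_nhds one_pos)] with r hr hx
    have hs := saddleScale_pos hd0 hr
    rw [norm_mul, Complex.norm_real, Real.norm_eq_abs, abs_of_nonneg (by positivity)]
    refine (mul_le_mul_of_nonneg_left (norm_exp_mul_I_sub_le hx) (by positivity)).trans_eq ?_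
    rw [abs_mul, abs_div, abs_of_pos hs, Nat.abs_cast]
    field_simp
  have := hrem.sub hquad
  have hlim : (0 : ℂ) - (if j = d then ((t ^ 2 / 2 : ℝ) : ℂ) else 0) =
      if j = d then ((-(t ^ 2 / 2) : ℝ) : ℂ) else 0 := by
    split_ifs <;> simp
  rw [hlim] at this
  refine this.congr fun r => ?_
  push_cast
  ring

/-- In the variable `t = θ √(d r ^ d)` the Fourier integrals converge to the Gaussian integral as
`r → ∞`. -/
lemma tendsto_integral_exp_saddleExponent (hA : ∀ j ∈ A, 0 < j) {d : ℕ} (hd : d ∈ A)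
    (hmax : ∀ j ∈ A, j ≤ d) (l : ℕ) :
    Tendsto (fun r => ∫ t in -(Real.pi / (A.gcd id : ℕ) * saddleScale d r)..
        Real.pi / (A.gcd id : ℕ) * saddleScale d r,
      Complex.exp (saddleExponent A r (t / saddleScale d r)) *
        Complex.exp ((l * (t / saddleScale d r) : ℝ) * Complex.I)) atTop
      (nhds ((√(2 * Real.pi) : ℝ) : ℂ)) := by
  have hd0 := hA d hd
  have hg := gcd_pos_of_mem hA hd
  have hgR : (0 : ℝ) < (A.gcd id : ℕ) := by exact_mod_cast hg
  set q : ℝ := Real.pi / (A.gcd id : ℕ) with hq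
  have hq0 : 0 < q := div_pos Real.pi_pos hgR
  obtain ⟨K, hK⟩ := exists_norm_exp_saddleExponent_le hA hd
  have hgauss : ∫ t : ℝ, ((Real.exp (-(t ^ 2 / 2)) : ℝ) : ℂ) = ((√(2 * Real.pi) : ℝ) : ℂ) := by
    rw [integral_complex_ofReal]
    have := integral_gaussian (1 / 2)
    have he : ∀ t : ℝ, -(t ^ 2 / 2) = -(1 / 2) * t ^ 2 := fun t => by ring
    simp only [he]
    rw [this]
    congr 2
    ring
  rw [← hgauss]
  set Ψ : ℝ → ℝ → ℂ := fun r t => Complex.exp (saddleExponent A r (t / saddleScale d r)) *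
        Complex.exp ((l * (t / saddleScale d r) : ℝ) * Complex.I) with hΨ
  have hcont : ∀ r, Continuous (Ψ r) := by
    intro r
    rw [hΨ]
    unfold saddleExponent
    fun_prop
  have hind : ∀ r, ∫ t, (Set.Ioc (-(q * saddleScale d r)) (q * saddleScale d r)).indicator (Ψ r) t =
      ∫ t in -(q * saddleScale d r)..q * saddleScale d r, Ψ r t := by
    intro r
    have : 0 ≤ q * saddleScale d r := mul_nonneg hq0.le (Real.sqrt_nonneg _)
    rw [MeasureTheory.integral_indicator measurableSet_Ioc,
      intervalIntegral.integral_of_le (by linarith)]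
  refine Tendsto.congr hind ?_
  refine MeasureTheory.tendsto_integral_filter_of_dominated_convergence
    (fun t => |K| * (1 + t ^ 2)⁻¹) ?_ ?_ (integrable_inv_one_add_sq.const_mul _) ?_
  · exact Eventually.of_forall fun r =>
      (hcont r).aestronglyMeasurable.indicator measurableSet_Ioc
  · filter_upwards [eventually_ge_atTop 1] with r hr
    refine Eventually.of_forall fun t => ?_
    by_cases ht : t ∈ Set.Ioc (-(q * saddleScale d r)) (q * saddleScale d r)
    · rw [Set.indicator_of_mem ht, hΨ, norm_mul, Complex.norm_exp_ofReal_mul_I, mul_one]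
      refine (hK r t hr (abs_le.2 ⟨ht.1.le, ht.2⟩)).trans ?_
      gcongr
      exact le_abs_self K
    · rw [Set.indicator_of_notMem ht, norm_zero]
      positivity
  · refine Eventually.of_forall fun t => ?_
    have hinv : Tendsto (fun r => (saddleScale d r)⁻¹) atTop (nhds 0) :=
      tendsto_inv_atTop_zero.comp (tendsto_saddleScale hd0)
    have h1 := (tendsto_saddleExponent hA hd hmax t).cexp
    have h2 : Tendsto (fun r => Complex.exp ((l * (t / saddleScale d r) : ℝ) * Complex.I)) atTop
        (nhds 1) := by
      have h3 : Tendsto (fun r => (l : ℝ) * (t / saddleScale d r)) atTop (nhds 0) := by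
        have := (hinv.const_mul t).const_mul (l : ℝ)
        simpa [div_eq_mul_inv] using this
      have h4 := (((Complex.continuous_ofReal.tendsto _).comp h3).mul_const Complex.I).cexp
      simpa using h4
    have h5 := h1.mul h2
    rw [mul_one, ← Complex.ofReal_exp] at h5
    refine h5.congr' ?_
    filter_upwards [((tendsto_saddleScale hd0).const_mul_atTop hq0).eventually_gt_atTop |t|]
      with r hr
    rw [Set.indicator_of_mem]
    have := abs_lt.1 hr
    exact ⟨this.1, this.2.le⟩

end Saddle

/-! ### Quotients of densities for a finite set of lengths -/

section Finite

variable {A : Finset ℕ}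

/-- At the saddle point, where `∑ r ^ j = N`, the coefficient of index `N - l` is a Fourier integral
without linear term. -/
lemma integral_exp_saddleExponent (hA : ∀ j ∈ A, 0 < j) {d : ℕ} (hd : d ∈ A) {r : ℝ} (hr : 0 < r)
    {N l : ℕ} (hN : ∑ j ∈ A, r ^ j = N) (hl : l ≤ N) (hdvd : A.gcd id ∣ N - l) :
    ∫ t in -(Real.pi / (A.gcd id : ℕ) * saddleScale d r)..
        Real.pi / (A.gcd id : ℕ) * saddleScale d r,
      Complex.exp (saddleExponent A r (t / saddleScale d r)) *
        Complex.exp ((l * (t / saddleScale d r) : ℝ) * Complex.I) =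
      (saddleScale d r * (2 * Real.pi / (A.gcd id : ℕ)) * Complex.exp (-cycleExponent A r)) *
        (restrictedDensity (A : Set ℕ) (N - l) * r ^ (N - l)) := by
  have hs := saddleScale_pos (hA d hd) hr
  have hg := gcd_pos_of_mem hA hd
  rw [intervalIntegral.integral_comp_div (fun θ : ℝ => Complex.exp (saddleExponent A r θ) *
        Complex.exp ((l * θ : ℝ) * Complex.I)) hs.ne', neg_div, mul_div_cancel_right₀ _ hs.ne']
  have hint : ∀ θ : ℝ, Complex.exp (saddleExponent A r θ) *
      Complex.exp ((l * θ : ℝ) * Complex.I) = Complex.exp (-cycleExponent A r) *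
        (Complex.exp (cycleExponent A (r * Complex.exp (θ * Complex.I))) *
          Complex.exp (-((N - l : ℕ) * θ) * Complex.I)) := by
    intro θ
    rw [← Complex.exp_add, ← Complex.exp_add, ← Complex.exp_add, saddleExponent_eq hA, hN]
    congr 1
    push_cast [hl]
    ring
  simp only [hint]
  rw [intervalIntegral.integral_const_mul, integral_exp_cycleExponent hA hg r hdvd,
    Complex.real_smul]
  ring

/-- The saddle points: the solutions `r` of `∑_{j ∈ A} r ^ j = N`. -/
lemma exists_saddlePoint (hA : ∀ j ∈ A, 0 < j) {d : ℕ} (hd : d ∈ A) (N : ℕ) :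
    ∃ r : ℝ, 0 ≤ r ∧ ∑ j ∈ A, r ^ j = N := by
  have hcont : ContinuousOn (fun r : ℝ => ∑ j ∈ A, r ^ j) (Set.Icc 0 N) :=
    Continuous.continuousOn (by fun_prop)
  have h0 : ∑ j ∈ A, (0 : ℝ) ^ j = 0 :=
    Finset.sum_eq_zero fun j hj => zero_pow (hA j hj).ne'
  have hN : (N : ℝ) ≤ ∑ j ∈ A, (N : ℝ) ^ j := by
    refine le_trans ?_ (Finset.single_le_sum (fun j _ => by positivity) hd)
    exact_mod_cast Nat.le_self_pow (hA d hd).ne' N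
  obtain ⟨r, hr, hrN⟩ := intermediate_value_Icc (Nat.cast_nonneg N) hcont
    (show (N : ℝ) ∈ Set.Icc _ _ from ⟨by simp [h0], hN⟩)
  exact ⟨r, hr.1, hrN⟩

lemma tendsto_sum_pow_div_pow {d : ℕ} (hd : d ∈ A) (hmax : ∀ j ∈ A, j ≤ d) :
    Tendsto (fun r : ℝ => (∑ j ∈ A, r ^ j) / r ^ d) atTop (nhds 1) := by
  classical
  have hterm : ∀ j ∈ A, Tendsto (fun r : ℝ => r ^ j / r ^ d) atTop
      (nhds (if j = d then 1 else 0)) := by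
    intro j hj
    split_ifs with h
    · subst h
      refine tendsto_const_nhds.congr' ?_
      filter_upwards [eventually_gt_atTop 0] with r hr
      rw [div_self (by positivity)]
    · exact tendsto_pow_div_pow_atTop_zero (lt_of_le_of_ne (hmax j hj) h)
  have := tendsto_finsetSum A hterm
  rw [Finset.sum_ite_eq', if_pos hd] at this
  simpa only [Finset.sum_div] using this

/-- For a finite set of lengths, the quotients of the densities grow like the powers of the saddle
point `r`, where `r ^ d ~ N`. -/
lemma tendsto_restrictedDensity_sub_div_finite (hA : ∀ j ∈ A, 0 < j) {d k : ℕ} (hd : d ∈ A)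
    (hmax : ∀ j ∈ A, j ≤ d) (hk : k ∈ A) :
    Tendsto (fun N : ℕ => restrictedDensity (A : Set ℕ) (N - k) / restrictedDensity (A : Set ℕ) N /
        (N : ℝ) ^ ((k : ℝ) / d))
      (atTop ⊓ 𝓟 {N | restrictedDensity (A : Set ℕ) N ≠ 0}) (nhds 1) := by
  have hd0 := hA d hd
  have hdR : (d : ℝ) ≠ 0 := by exact_mod_cast hd0.ne'
  choose r hr0 hrN using exists_saddlePoint hA hd
  have hr : Tendsto r atTop atTop := by
    refine tendsto_atTop.2 fun R => ?_
    filter_upwards [tendsto_natCast_atTop_atTop.eventually_gt_atTop (∑ j ∈ A, R ^ j)] with N hN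
    by_contra! hlt
    rw [← hrN N] at hN
    exact hN.not_ge (Finset.sum_le_sum fun j _ => pow_le_pow_left₀ (hr0 N) hlt.le j)
  set F : Filter ℕ := atTop ⊓ 𝓟 {N | restrictedDensity (A : Set ℕ) N ≠ 0} with hF
  have hrF : Tendsto r F atTop := hr.mono_left inf_le_left
  have hrpos : ∀ᶠ N in F, 0 < r N := hrF.eventually_gt_atTop 0
  have hNk : ∀ᶠ N in F, k ≤ N := (eventually_ge_atTop k).filter_mono inf_le_left
  have hne : ∀ᶠ N in F, restrictedDensity (A : Set ℕ) N ≠ 0 :=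
    (eventually_principal.2 fun N hN => hN).filter_mono inf_le_right
  have hlim := fun l => (tendsto_integral_exp_saddleExponent hA hd hmax l).comp hrF
  have hG : ((√(2 * Real.pi) : ℝ) : ℂ) ≠ 0 := by
    rw [Complex.ofReal_ne_zero]; positivity
  have hquot := (hlim k).div (hlim 0) hG
  rw [div_self hG] at hquot
  have hreal : Tendsto (fun N => restrictedDensity (A : Set ℕ) (N - k) /
      restrictedDensity (A : Set ℕ) N / r N ^ k) F (nhds 1) := by
    have h1 : Tendsto (fun N => ((restrictedDensity (A : Set ℕ) (N - k) /
        restrictedDensity (A : Set ℕ) N / r N ^ k : ℝ) : ℂ)) F (nhds 1) := by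
      refine hquot.congr' ?_
      filter_upwards [hrpos, hNk, hne] with N hrp hkN hN
      have hdvd := dvd_of_restrictedDensity_ne_zero N hN
      have hdvdk : A.gcd id ∣ N - k := Nat.dvd_sub hdvd (Finset.gcd_dvd (f := id) hk)
      simp only [Pi.div_apply, Function.comp_apply]
      rw [integral_exp_saddleExponent hA hd hrp (hrN N) hkN hdvdk,
        integral_exp_saddleExponent hA hd hrp (hrN N) (Nat.zero_le N) (by simpa using hdvd),
        Nat.sub_zero]
      have hC : ((saddleScale d (r N) : ℂ) * (2 * Real.pi / (A.gcd id : ℕ)) *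
          Complex.exp (-cycleExponent A (r N))) ≠ 0 := by
        have h2 : (saddleScale d (r N) : ℂ) ≠ 0 := by
          exact_mod_cast (saddleScale_pos hd0 hrp).ne'
        have h3 : ((A.gcd id : ℕ) : ℂ) ≠ 0 := by exact_mod_cast (gcd_pos_of_mem hA hd).ne'
        have h4 : (Real.pi : ℂ) ≠ 0 := by exact_mod_cast Real.pi_ne_zero
        exact mul_ne_zero (mul_ne_zero h2 (div_ne_zero (mul_ne_zero two_ne_zero h4) h3))
          (Complex.exp_ne_zero _)
      rw [mul_div_mul_left _ _ hC]
      have hrc : ((r N : ℝ) : ℂ) ≠ 0 := by exact_mod_cast hrp.ne'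
      have hac : ((restrictedDensity (A : Set ℕ) N : ℝ) : ℂ) ≠ 0 := by exact_mod_cast hN
      have hpow : ((r N : ℝ) : ℂ) ^ N = (r N : ℂ) ^ (N - k) * (r N : ℂ) ^ k := by
        rw [← pow_add, Nat.sub_add_cancel hkN]
      rw [hpow]
      push_cast
      field_simp
    have h5 := (Complex.continuous_re.tendsto _).comp h1
    simpa only [Function.comp_def, Complex.ofReal_re, Complex.one_re] using h5
  -- `r ^ d ~ N` turns `r ^ k` into `N ^ (k / d)`.
  have hpow : Tendsto (fun N : ℕ => r N ^ k / (N : ℝ) ^ ((k : ℝ) / d)) F (nhds 1) := by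
    have h1 := ((tendsto_sum_pow_div_pow hd hmax).comp hrF).inv₀ one_ne_zero
    have h2 := h1.rpow_const (p := (k : ℝ) / d) (Or.inl (by simp))
    simp only [inv_one, Real.one_rpow] at h2
    refine h2.congr' ?_
    filter_upwards [hrpos] with N hrp
    simp only [Function.comp_apply, hrN, inv_div]
    rw [Real.div_rpow (by positivity) (Nat.cast_nonneg N), ← Real.rpow_natCast (r N) d,
      ← Real.rpow_mul hrp.le, mul_div_cancel₀ _ hdR, Real.rpow_natCast]
  have := hreal.mul hpow
  rw [one_mul] at this
  refine this.congr' ?_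
  filter_upwards [hrpos] with N hrp
  field_simp

end Finite

/-! ### The probability of lying in a cycle of given length -/

lemma lengthRatio_of_isGreatest {A : Set ℕ} {d : ℕ} (hd : IsGreatest A d) (k : ℕ) :
    lengthRatio A k = (k : ℝ) / d := by
  have : supLength A = d := by
    refine le_antisymm (iSup₂_le fun a ha => ?_) (le_iSup₂_of_le d hd.1 le_rfl)
    exact_mod_cast hd.2 ha
  simp [lengthRatio, this, ENNReal.toReal_div]

lemma lengthRatio_of_infinite {A : Set ℕ} (hA : A.Infinite) (k : ℕ) : lengthRatio A k = 0 := by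
  have : supLength A = ⊤ := by
    refine ENNReal.eq_top_of_forall_nnreal_le fun x => ?_
    obtain ⟨n, hn⟩ := exists_nat_ge x
    obtain ⟨a, ha, hna⟩ := hA.exists_gt n
    refine le_iSup₂_of_le a ha ?_
    have : x ≤ (a : NNReal) := hn.trans (by exact_mod_cast hna.le)
    exact_mod_cast this
  simp [lengthRatio, this]

/-- The growth of the quotients of densities in both cases of the hypothesis on `A`. -/
lemma tendsto_restrictedDensity_quotient {A : Set ℕ} (hApos : ∀ a ∈ A, 0 < a)
    (hA : A.Finite ∨ Summable (fun j : {j : ℕ // 0 < j ∧ j ∉ A} => 1 / ((j : ℕ) : ℝ)))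
    {k : ℕ} (hk : k ∈ A) :
    Tendsto (fun N : ℕ => restrictedDensity A (N - k) / restrictedDensity A N /
        (N : ℝ) ^ lengthRatio A k)
      (atTop ⊓ 𝓟 {N | restrictedDensity A N ≠ 0}) (nhds 1) := by
  by_cases hfin : A.Finite
  · obtain ⟨A, rfl⟩ := hfin.exists_finset_coe
    have hne : A.Nonempty := ⟨k, by exact_mod_cast hk⟩
    have hd : IsGreatest (A : Set ℕ) (A.max' hne) := A.isGreatest_max' hne
    rw [lengthRatio_of_isGreatest hd]
    exact tendsto_restrictedDensity_sub_div_finite (fun j hj => hApos j (by exact_mod_cast hj))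
      (by exact_mod_cast hd.1) (fun j hj => hd.2 (by exact_mod_cast hj)) (by exact_mod_cast hk)
  · have hs := hA.resolve_left hfin
    simp only [lengthRatio_of_infinite hfin, Real.rpow_zero, div_one]
    exact (tendsto_restrictedDensity_sub_div (B := {j | 0 < j ∧ j ∉ A}) (fun b hb => hb.1)
      (fun j hj => by simp [hj]) hs k).mono_left inf_le_left

theorem mainTheorem4 (A : Set ℕ) (hApos : ∀ a ∈ A, 0 < a)
    (hA : A.Finite ∨ Summable (fun j : {j : ℕ // 0 < j ∧ j ∉ A} => 1 / ((j : ℕ) : ℝ)))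
    (k : ℕ) (hk : k ∈ A) (i : (N : ℕ+) → Fin (N : ℕ)) :
    IsEquivalent (atTop ⊓ 𝓟 {N : ℕ+ | (restrictedPerms A (N : ℕ)).Nonempty})
      (fun N : ℕ+ => cycleProb A k (N : ℕ) (i N))
      (fun N : ℕ+ => ((N : ℕ) : ℝ) ^ (lengthRatio A k - 1)) := by
  have hval : Tendsto (fun N : ℕ+ => (N : ℕ))
      (atTop ⊓ 𝓟 {N : ℕ+ | (restrictedPerms A (N : ℕ)).Nonempty})
      (atTop ⊓ 𝓟 {N | restrictedDensity A N ≠ 0}) := by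
    refine Tendsto.inf tendsto_PNat_val_atTop_atTop (tendsto_principal_principal.2 fun N hN => ?_)
    exact (restrictedDensity_ne_zero_iff A N).2 hN
  have hkN : ∀ᶠ N : ℕ+ in atTop ⊓ 𝓟 {N : ℕ+ | (restrictedPerms A (N : ℕ)).Nonempty},
      k ≤ (N : ℕ) :=
    (tendsto_PNat_val_atTop_atTop.eventually_ge_atTop k).filter_mono inf_le_left
  refine isEquivalent_of_tendsto_one ?_
  refine ((tendsto_restrictedDensity_quotient hApos hA hk).comp hval).congr' ?_
  filter_upwards [hkN] with N hN
  have hN0 : (0 : ℝ) < (N : ℕ) := by exact_mod_cast N.pos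
  simp only [Function.comp_apply, Pi.div_apply]
  rw [cycleProb_eq hk (hApos k hk) hN, Real.rpow_sub_one hN0.ne']
  field_simp
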